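/- Fix a countably saturated nonstandard universe, that is, an extension $a\mapsto{}^*a$ of the superstructure over $\mathbb N$ which satisfies the transfer principle and in which every countable family of internal sets with the finite intersection property has nonempty intersection; let ${}^*\mathbb N$ be its set of hyperintegers. A subset $X$ of ${}^*\mathbb N$ (or of ${}^*\mathbb N\times{}^*\mathbb N$) is called countably determined (CD) if there are internal sets $X_m$ ($m\in\mathbb N$) and a set $B\subseteq\mathcal P(\mathbb N)$ such that $$X=\bigcup_{b\in B}\Bigl(\bigcap_{m\in b}X_m\cap\bigcap_{m\notin b}\overline X_m\Bigr),\qquad \overline X_m=\Bigl(\bigcup_n X_n\Bigr)\setminus X_m .$$ A map is CD if its graph is CD. Theorem. Let $E$ be an equivalence relation on ${}^*\mathbb N$ which is CD as a subset of ${}^*\mathbb N\times{}^*\mathbb N$ and all of whose equivalence classes are at most countable. Then $E$ has a CD transversal, that is, there is a CD set $T\subseteq{}^*\mathbb N$ which has exactly one element in common with each $E$-class. Hence $E$ is CD-smooth, that is, there is a CD map $\vartheta:{}^*\mathbb N\to{}^*\mathbb N$ such that for all $x,y\in{}^*\mathbb N$: $x\mathrel E y$ if and only if $\vartheta(x)=\vartheta(y)$.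 -/

import Mathlib

universe u

namespace NonstandardDST

/-- The superstructure over `ℕ`, presented level by level:
`ℕ`, `𝒫(ℕ)`, `𝒫(𝒫(ℕ))`, and so on through all finite levels. Pairs, relations, functions, families
of sets, etc. are coded in it as usual, through Kuratowski pairs. -/
def Level : ℕ → Type
  | 0 => ℕ
  | n + 1 => Set (Level n)

/-- A structure with a domain of objects of each finite level and a membership relation
between consecutive levels. -/
structure LevelStructure where
  Obj : ℕ → Type u
  mem : ∀ n : ℕ, Obj n → Obj (n + 1) → Prop

/-- The standard universe: the full superstructure over `ℕ` with its true membership. -/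
abbrev standard : LevelStructure.{0} where
  Obj := Level
  mem := fun n a (b : Set (Level n)) => a ∈ b

/-- Formulas of set theory in which every quantifier is bounded by a level. The variables of
level `n` are `v n 0, v n 1, v n 2, …`. -/
inductive Formula : Type
  /-- `v n i = v n j` -/
  | eq (n i j : ℕ) : Formula
  /-- `v n i ∈ v (n + 1) j` -/
  | mem (n i j : ℕ) : Formula
  | neg (φ : Formula) : Formula
  | and (φ ψ : Formula) : Formula
  /-- `∀ v n i, φ`, the quantifier running over all objects of level `n` -/
  | all (n i : ℕ) (φ : Formula) : Formula

/-- Truth of a formula in `S`, the variables being evaluated by `e`. -/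
def LevelStructure.Sat (S : LevelStructure.{u}) : Formula → (∀ n : ℕ, ℕ → S.Obj n) → Prop
  | .eq n i j, e => e n i = e n j
  | .mem n i j, e => S.mem n (e n i) (e (n + 1) j)
  | .neg φ, e => ¬ S.Sat φ e
  | .and φ ψ, e => S.Sat φ e ∧ S.Sat ψ e
  | .all n i φ, e =>
      ∀ a : S.Obj n, S.Sat φ (Function.update e n (Function.update (e n) i a))

/-- A nonstandard universe over the superstructure of `ℕ`: `Obj n` is the set of the internal
objects of level `n`, that is, the elements of `*(Level n)` (so `Obj 0` is `*ℕ`, `Obj 1` is the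
set of the internal subsets of `*ℕ`, and so on), and `star` is the map `a ↦ *a`, subject to the
transfer principle for all formulas with arbitrary standard parameters. -/
structure NonstandardUniverse extends LevelStructure.{u} where
  star : ∀ n : ℕ, Level n → Obj n
  transfer : ∀ (φ : Formula) (e : ∀ n : ℕ, ℕ → Level n),
    standard.Sat φ e ↔ toLevelStructure.Sat φ (fun n i => star n (e n i))

namespace NonstandardUniverse

variable (U : NonstandardUniverse.{u})

/-- Countable saturation: every sequence of internal sets (of any level) in which any finitely
many sets have a common element has a common element. -/
def CountablySaturated : Prop :=
  ∀ (n : ℕ) (b : ℕ → U.Obj (n + 1)),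
    (∀ k : ℕ, ∃ x : U.Obj n, ∀ i ≤ k, U.mem n x (b i)) →
      ∃ x : U.Obj n, ∀ i : ℕ, U.mem n x (b i)

/-- The set `*ℕ` of hyperintegers. -/
abbrev HyperNat : Type u := U.Obj 0

/-- `p` is the Kuratowski pair `{{x}, {x, y}}` of the hyperintegers `x` and `y`. -/
def IsPair (p : U.Obj 2) (x y : U.HyperNat) : Prop :=
  ∀ c : U.Obj 1, U.mem 1 c p ↔
    (∀ z : U.HyperNat, U.mem 0 z c ↔ z = x) ∨
      (∀ z : U.HyperNat, U.mem 0 z c ↔ z = x ∨ z = y)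

/-- Internal subsets of `*ℕ`. -/
def IsInternal (X : Set U.HyperNat) : Prop :=
  ∃ b : U.Obj 1, X = {x | U.mem 0 x b}

/-- Internal subsets of `*ℕ × *ℕ`. -/
def IsInternalRel (P : Set (U.HyperNat × U.HyperNat)) : Prop :=
  ∃ b : U.Obj 3, P = {q | ∃ p : U.Obj 2, U.IsPair p q.1 q.2 ∧ U.mem 2 p b}

end NonstandardUniverse

/-- `X` is countably determined over a class `𝓘` of sets: for some sets `Y m ∈ 𝓘` and some
`B ⊆ 𝒫(ℕ)`, `X` is the union over `b ∈ B` of the intersection of all `Y m` with `m ∈ b` and all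
`(⋃ n, Y n) \ Y m` with `m ∉ b`. -/
def CountablyDetermined {α : Type u} (𝓘 : Set α → Prop) (X : Set α) : Prop :=
  ∃ (Y : ℕ → Set α) (B : Set (Set ℕ)), (∀ m, 𝓘 (Y m)) ∧
    X = ⋃ b ∈ B, ((⋂ m ∈ b, Y m) ∩ ⋂ m ∈ bᶜ, ((⋃ n, Y n) \ Y m))

namespace NonstandardUniverse

variable (U : NonstandardUniverse.{u})

/-- Countably determined subsets of `*ℕ`. -/
def IsCD (X : Set U.HyperNat) : Prop :=
  CountablyDetermined U.IsInternal X

/-- Countably determined subsets of `*ℕ × *ℕ`. -/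
def IsCDRel (P : Set (U.HyperNat × U.HyperNat)) : Prop :=
  CountablyDetermined U.IsInternalRel P

/-- A map `*ℕ → *ℕ` is countably determined if its graph is. -/
def IsCDMap (θ : U.HyperNat → U.HyperNat) : Prop :=
  U.IsCDRel {q | θ q.1 = q.2}

/-- An equivalence relation on `*ℕ` is CD-smooth if it is CD-reducible to equality on `*ℕ`. -/
def CDSmooth (E : Setoid U.HyperNat) : Prop :=
  ∃ θ : U.HyperNat → U.HyperNat, U.IsCDMap θ ∧ ∀ x y, E x y ↔ θ x = θ y

end NonstandardUniverse

/-- `T` has exactly one common element with each equivalence class of `E`. -/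
def IsTransversal {α : Type u} (E : Setoid α) (T : Set α) : Prop :=
  ∀ x : α, ∃! y : α, y ∈ T ∧ E x y

end NonstandardDST

/-! Saturation turns countability into finiteness. The points `z` for which `(x, z)` has the same
position as `(x, y) ∈ E` with respect to the internal sets determining `E` form a decreasing
intersection of internal sets inside the class of `x`. This intersection is countable, so one of
those sets is already finite (`exists_finite`), and `y` is its `i`-th least element for some `i`.
Hence countably many internal partial functions `G n` cover `E` (`IsCDRel.exists_cover`).

By transfer, each `G n` has an internal two-colouring `A n` separating a point from its image
whenever the image is smaller. Any two distinct equivalent points are separated by some `A n`, so `τ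
x = {n | x ∈ A n}` is injective on each class. Picking the point of each class whose `τ` is least in
a well-ordering of `𝒫(ℕ)` gives a transversal. It is CD because the set of values of `τ` on the
class of `x` depends only on the position of `x` with respect to countably many internal sets
(`CountablyDetermined.of_invariant`). -/

namespace NonstandardDST

open Function

/-! ### Derived formulas and their satisfaction -/

namespace Formula

/-- Disjunction. -/
def or (φ ψ : Formula) : Formula := .neg (.and (.neg φ) (.neg ψ))

/-- Implication. -/
def imp (φ ψ : Formula) : Formula := .neg (.and φ (.neg ψ))

/-- Equivalence. -/
def iff (φ ψ : Formula) : Formula := .and (φ.imp ψ) (ψ.imp φ)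

/-- Existential quantification over the objects of level `n`. -/
def ex (n i : ℕ) (φ : Formula) : Formula := .neg (.all n i (.neg φ))

/-- `v 2 p` is the Kuratowski pair of `v 0 x` and `v 0 y`. -/
def pair (p x y : ℕ) : Formula :=
  -- The bound index `x + y + 1` differs from both `x` and `y`, so no variable is captured.
  .all 1 0 (iff (.mem 1 0 p)
    (or (.all 0 (x + y + 1) (iff (.mem 0 (x + y + 1) 0) (.eq 0 (x + y + 1) x)))
      (.all 0 (x + y + 1) (iff (.mem 0 (x + y + 1) 0)
        (or (.eq 0 (x + y + 1) x) (.eq 0 (x + y + 1) y))))))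

/-- The pair of `v 0 x` and `v 0 y` belongs to `v 3 r`. -/
def rel (r x y : ℕ) : Formula := ex 2 0 (.and (pair 0 x y) (.mem 2 0 r))

end Formula

namespace LevelStructure

variable (S : LevelStructure.{u})

/-- The binary relation on the objects of level `0` which is coded by an object of level `3`. -/
def Rel (b : S.Obj 3) (x y : S.Obj 0) : Prop :=
  ∃ p : S.Obj 2, (∀ c : S.Obj 1, S.mem 1 c p ↔
    (∀ z : S.Obj 0, S.mem 0 z c ↔ z = x) ∨
      (∀ z : S.Obj 0, S.mem 0 z c ↔ z = x ∨ z = y)) ∧ S.mem 2 p b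

variable {S} {e : ∀ n : ℕ, ℕ → S.Obj n}

@[simp] theorem sat_eq {n i j : ℕ} : S.Sat (.eq n i j) e ↔ e n i = e n j := Iff.rfl

@[simp] theorem sat_mem {n i j : ℕ} :
    S.Sat (.mem n i j) e ↔ S.mem n (e n i) (e (n + 1) j) := Iff.rfl

@[simp] theorem sat_neg {φ : Formula} : S.Sat φ.neg e ↔ ¬ S.Sat φ e := Iff.rfl

@[simp] theorem sat_and {φ ψ : Formula} :
    S.Sat (φ.and ψ) e ↔ S.Sat φ e ∧ S.Sat ψ e := Iff.rfl

@[simp] theorem sat_all {n i : ℕ} {φ : Formula} :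
    S.Sat (.all n i φ) e ↔ ∀ a : S.Obj n, S.Sat φ (update e n (update (e n) i a)) := Iff.rfl

@[simp] theorem sat_or {φ ψ : Formula} : S.Sat (φ.or ψ) e ↔ S.Sat φ e ∨ S.Sat ψ e := by
  simp only [Formula.or, sat_neg, sat_and]; tauto

@[simp] theorem sat_imp {φ ψ : Formula} : S.Sat (φ.imp ψ) e ↔ (S.Sat φ e → S.Sat ψ e) := by
  simp only [Formula.imp, sat_neg, sat_and]; tauto

@[simp] theorem sat_iff {φ ψ : Formula} : S.Sat (φ.iff ψ) e ↔ (S.Sat φ e ↔ S.Sat ψ e) := by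
  simp only [Formula.iff, sat_imp, sat_and]; tauto

@[simp] theorem sat_ex {n i : ℕ} {φ : Formula} :
    S.Sat (φ.ex n i) e ↔ ∃ a : S.Obj n, S.Sat φ (update e n (update (e n) i a)) := by
  simp [Formula.ex]

@[simp] theorem sat_rel {r x y : ℕ} :
    S.Sat (.rel r x y) e ↔ S.Rel (e 3 r) (e 0 x) (e 0 y) := by
  have hx : x ≠ x + y + 1 := by omega
  have hy : y ≠ x + y + 1 := by omega
  simp [Formula.rel, Formula.pair, Rel, hx, hy]

end LevelStructure

/-! ### Relations in the standard universe -/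

/-- The Kuratowski pair of two natural numbers. -/
def stdPair (x y : ℕ) : Level 2 :=
  ({c : Set ℕ | c = {x} ∨ c = {x, y}} : Set (Set ℕ))

theorem isPair_iff_eq_stdPair (p : Level 2) (x y : Level 0) :
    (∀ c : Level 1, standard.mem 1 c p ↔
      (∀ z : Level 0, standard.mem 0 z c ↔ z = x) ∨
        (∀ z : Level 0, standard.mem 0 z c ↔ z = x ∨ z = y)) ↔ p = stdPair x y := by
  have key : ∀ c : Set ℕ, ((∀ z : ℕ, z ∈ c ↔ z = x) ∨ (∀ z : ℕ, z ∈ c ↔ z = x ∨ z = y)) ↔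
      c = {(x : ℕ)} ∨ c = {(x : ℕ), (y : ℕ)} := by
    intro c
    rw [Set.ext_iff, Set.ext_iff]
    exact Iff.rfl
  constructor
  · intro h
    exact Set.ext fun c => (h c).trans (key c)
  · rintro rfl c
    exact (key c).symm

theorem stdPair_injective {x y x' y' : ℕ} (h : stdPair x y = stdPair x' y') :
    x = x' ∧ y = y' := by
  have h' : ({{x}, {x, y}} : Set (Set ℕ)) = {{x'}, {x', y'}} := h
  have h1 : ({x} : Set ℕ) ∈ ({{x'}, {x', y'}} : Set (Set ℕ)) := h' ▸ by simp
  have h2 : ({x, y} : Set ℕ) ∈ ({{x'}, {x', y'}} : Set (Set ℕ)) := h' ▸ by simp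
  have h3 : ({x', y'} : Set ℕ) ∈ ({{x}, {x, y}} : Set (Set ℕ)) := h' ▸ by simp
  simp only [Set.mem_insert_iff, Set.mem_singleton_iff, Set.ext_iff] at h1 h2 h3
  have hx : x = x' := by
    rcases h1 with h1 | h1
    exacts [(h1 x).1 rfl, ((h1 x').2 (.inl rfl)).symm]
  have h4 := h2.imp (fun h => h y) (fun h => h y)
  have h5 := h3.imp (fun h => h y') (fun h => h y')
  omega

/-- The code of a binary relation on `ℕ`. -/
def stdRel (P : ℕ → ℕ → Prop) : Level 3 :=
  ({p : Level 2 | ∃ x y, P x y ∧ p = stdPair x y} : Set (Level 2))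

theorem standard_rel_stdRel (P : ℕ → ℕ → Prop) (x y : ℕ) :
    standard.Rel (stdRel P) x y ↔ P x y := by
  constructor
  · rintro ⟨p, hp, x', y', hP, rfl⟩
    obtain ⟨rfl, rfl⟩ := stdPair_injective ((isPair_iff_eq_stdPair _ x y).1 hp)
    exact hP
  · intro h
    exact ⟨stdPair x y, (isPair_iff_eq_stdPair _ x y).2 rfl, x, y, h, rfl⟩

theorem exists_standard_rel (P : ℕ → ℕ → Prop) :
    ∃ b : Level 3, ∀ x y : Level 0, standard.Rel b x y ↔ P x y :=
  ⟨stdRel P, standard_rel_stdRel P⟩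

theorem exists_standard_mem (P : ℕ → Prop) :
    ∃ b : Level 1, ∀ x : Level 0, standard.mem 0 x b ↔ P x :=
  ⟨({x : ℕ | P x} : Set ℕ), fun _ => Iff.rfl⟩

/-- An evaluation of the variables in the standard universe under which `v 3 0` is the order
of `ℕ`. -/
def stdEnv : ∀ n : ℕ, ℕ → Level n
  | 0, _ => (0 : ℕ)
  | 1, _ => (∅ : Set (Level 0))
  | 2, _ => (∅ : Set (Level 1))
  | 3, _ => stdRel (· < ·)
  | n + 4, _ => (∅ : Set (Level (n + 3)))

@[simp] theorem standard_rel_stdEnv (i : ℕ) (x y : Level 0) :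
    standard.Rel (stdEnv 3 i) x y ↔ (show ℕ from x) < (show ℕ from y) :=
  standard_rel_stdRel _ x y

/-- A partial regressive function on `ℕ` admits a colouring with two colours in which every point
differs from its image. -/
theorem exists_coloring_of_regressive (R : ℕ → ℕ → Prop)
    (hR : ∀ x y z, R x y → R x z → y = z) :
    ∃ A : ℕ → Prop, ∀ x y, R x y → y < x → (A x ↔ ¬ A y) := by
  -- Recursion along `<`: a point takes the colour opposite to that of its smaller image, and the
  -- colour `False` if there is none.
  let F : ∀ x : ℕ, (∀ y, y < x → Prop) → Prop := fun x A => ∃ y, ∃ h : y < x, R x y ∧ ¬ A y h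
  refine ⟨Nat.lt_wfRel.wf.fix F, fun x y hxy hlt => ?_⟩
  rw [WellFounded.fix_eq]
  constructor
  · rintro ⟨z, hz, hxz, hA⟩
    rwa [hR x y z hxy hxz]
  · exact fun h => ⟨y, hlt, hxy, h⟩

/-! ### Internal sets and relations -/

namespace NonstandardUniverse

variable {U : NonstandardUniverse.{u}}

/-- The extension to `*ℕ` of the order of `ℕ`. -/
def Lt (U : NonstandardUniverse.{u}) (x y : U.HyperNat) : Prop :=
  U.toLevelStructure.Rel (U.star 3 (stdEnv 3 0)) x y

theorem isInternalRel_iff {P : Set (U.HyperNat × U.HyperNat)} :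
    U.IsInternalRel P ↔ ∃ b : U.Obj 3, ∀ x y, (x, y) ∈ P ↔ U.toLevelStructure.Rel b x y := by
  constructor
  · rintro ⟨b, rfl⟩
    exact ⟨b, fun _ _ => Iff.rfl⟩
  · rintro ⟨b, hb⟩
    exact ⟨b, Set.ext fun q => hb q.1 q.2⟩

theorem isInternal_iff {X : Set U.HyperNat} :
    U.IsInternal X ↔ ∃ b : U.Obj 1, ∀ x, x ∈ X ↔ U.mem 0 x b := by
  constructor
  · rintro ⟨b, rfl⟩
    exact ⟨b, fun _ => Iff.rfl⟩
  · rintro ⟨b, hb⟩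
    exact ⟨b, Set.ext hb⟩

/-! ### Closure properties of internal sets, by transfer -/

theorem isInternal_univ : U.IsInternal Set.univ := by
  have h := (U.transfer (.ex 1 1 (.all 0 0 (.mem 0 0 1))) stdEnv).1 (by
    simpa using (exists_standard_mem fun _ => True))
  simp at h
  exact isInternal_iff.2 (by simpa using h)

theorem isInternalRel_univ : U.IsInternalRel Set.univ := by
  have h := (U.transfer (.ex 3 1 (.all 0 0 (.all 0 1 (.rel 1 0 1)))) stdEnv).1 (by
    simpa using (exists_standard_rel fun _ _ => True))
  simp at h
  exact isInternalRel_iff.2 (by simpa using h)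

theorem IsInternalRel.inter {P Q : Set (U.HyperNat × U.HyperNat)} (hP : U.IsInternalRel P)
    (hQ : U.IsInternalRel Q) : U.IsInternalRel (P ∩ Q) := by
  have h := (U.transfer (.all 3 1 (.all 3 2 (.ex 3 3 (.all 0 0 (.all 0 1
    (.iff (.rel 3 0 1) (.and (.rel 1 0 1) (.rel 2 0 1)))))))) stdEnv).1 (by
      simp
      intro a b
      exact exists_standard_rel _)
  simp at h
  obtain ⟨a, ha⟩ := isInternalRel_iff.1 hP
  obtain ⟨b, hb⟩ := isInternalRel_iff.1 hQ
  obtain ⟨c, hc⟩ := h a b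
  exact isInternalRel_iff.2 ⟨c, fun x y => by simp [hc, ha, hb]⟩

theorem IsInternalRel.compl {P : Set (U.HyperNat × U.HyperNat)} (hP : U.IsInternalRel P) :
    U.IsInternalRel Pᶜ := by
  have h := (U.transfer (.all 3 1 (.ex 3 3 (.all 0 0 (.all 0 1
    (.iff (.rel 3 0 1) (.neg (.rel 1 0 1))))))) stdEnv).1 (by
      simp
      intro a
      exact exists_standard_rel _)
  simp at h
  obtain ⟨a, ha⟩ := isInternalRel_iff.1 hP
  obtain ⟨c, hc⟩ := h a
  exact isInternalRel_iff.2 ⟨c, fun x y => by simp [hc, ha]⟩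

/-- The relation `P` without the least point of each section. -/
def removeLeast (P : Set (U.HyperNat × U.HyperNat)) : Set (U.HyperNat × U.HyperNat) :=
  {q | q ∈ P ∧ ∃ z, U.Lt z q.2 ∧ (q.1, z) ∈ P}

/-- The graph of the partial function which maps `x` to the least point of the section of `P`
at `x`. -/
def leastGraph (P : Set (U.HyperNat × U.HyperNat)) : Set (U.HyperNat × U.HyperNat) :=
  P ∩ (removeLeast P)ᶜ

theorem IsInternalRel.removeLeast {P : Set (U.HyperNat × U.HyperNat)} (hP : U.IsInternalRel P) :
    U.IsInternalRel (removeLeast P) := by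
  have h := (U.transfer (.all 3 1 (.ex 3 3 (.all 0 0 (.all 0 1
    (.iff (.rel 3 0 1) (.and (.rel 1 0 1) (.ex 0 2 (.and (.rel 0 2 1) (.rel 1 0 2)))))))))
      stdEnv).1 (by
      simp
      intro a
      exact exists_standard_rel _)
  simp at h
  obtain ⟨a, ha⟩ := isInternalRel_iff.1 hP
  obtain ⟨c, hc⟩ := h a
  exact isInternalRel_iff.2 ⟨c, fun x y => by simp [hc, ha, NonstandardUniverse.removeLeast, Lt]⟩

theorem IsInternalRel.leastGraph {P : Set (U.HyperNat × U.HyperNat)} (hP : U.IsInternalRel P) :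
    U.IsInternalRel (leastGraph P) :=
  hP.inter hP.removeLeast.compl

theorem IsInternalRel.preimage {P : Set (U.HyperNat × U.HyperNat)} {A : Set U.HyperNat}
    (hP : U.IsInternalRel P) (hA : U.IsInternal A) :
    U.IsInternal {x | ∃ y, (x, y) ∈ P ∧ y ∈ A} := by
  have h := (U.transfer (.all 3 1 (.all 1 1 (.ex 1 2 (.all 0 0
    (.iff (.mem 0 0 2) (.ex 0 1 (.and (.rel 1 0 1) (.mem 0 1 1)))))))) stdEnv).1 (by
      simp
      intro a b
      exact exists_standard_mem _)
  simp at h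
  obtain ⟨a, ha⟩ := isInternalRel_iff.1 hP
  obtain ⟨b, hb⟩ := isInternal_iff.1 hA
  obtain ⟨c, hc⟩ := h a b
  exact isInternal_iff.2 ⟨c, fun x => by simp [hc, ha, hb]⟩

theorem IsInternalRel.dom {P : Set (U.HyperNat × U.HyperNat)} (hP : U.IsInternalRel P) :
    U.IsInternal {x | ∃ y, (x, y) ∈ P} := by
  simpa using hP.preimage isInternal_univ

theorem IsInternal.preimage_snd {A : Set U.HyperNat} (hA : U.IsInternal A) :
    U.IsInternalRel {q | q.2 ∈ A} := by
  have h := (U.transfer (.all 1 1 (.ex 3 3 (.all 0 0 (.all 0 1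
    (.iff (.rel 3 0 1) (.mem 0 1 1)))))) stdEnv).1 (by
      simp
      intro a
      exact exists_standard_rel fun _ y => standard.mem 0 y a)
  simp at h
  obtain ⟨a, ha⟩ := isInternal_iff.1 hA
  obtain ⟨c, hc⟩ := h a
  exact isInternalRel_iff.2 ⟨c, fun x y => by simp [hc, ha]⟩

theorem IsInternalRel.section {P : Set (U.HyperNat × U.HyperNat)} (hP : U.IsInternalRel P)
    (x : U.HyperNat) : U.IsInternal {y | (x, y) ∈ P} := by
  have h := (U.transfer (.all 3 1 (.all 0 0 (.ex 1 1 (.all 0 1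
    (.iff (.mem 0 1 1) (.rel 1 0 1)))))) stdEnv).1 (by
      simp
      intro a x
      exact exists_standard_mem _)
  simp at h
  obtain ⟨a, ha⟩ := isInternalRel_iff.1 hP
  obtain ⟨c, hc⟩ := h a x
  exact isInternal_iff.2 ⟨c, fun y => by simp [hc, ha]⟩

theorem IsInternal.diff_singleton {A : Set U.HyperNat} (hA : U.IsInternal A) (x : U.HyperNat) :
    U.IsInternal (A \ {x}) := by
  have h := (U.transfer (.all 1 1 (.all 0 0 (.ex 1 2 (.all 0 1
    (.iff (.mem 0 1 2) (.and (.mem 0 1 1) (.neg (.eq 0 1 0)))))))) stdEnv).1 (by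
      simp
      intro a x
      exact exists_standard_mem fun y => standard.mem 0 y a ∧ ¬ y = x)
  simp at h
  obtain ⟨a, ha⟩ := isInternal_iff.1 hA
  obtain ⟨c, hc⟩ := h a x
  exact isInternal_iff.2 ⟨c, fun y => by simp [hc, ha]⟩

theorem IsInternal.diff_finite {A : Set U.HyperNat} (hA : U.IsInternal A) {F : Set U.HyperNat}
    (hF : F.Finite) : U.IsInternal (A \ F) := by
  induction F, hF using Set.Finite.induction_on with
  | empty => simpa using hA
  | @insert a s _ _ ih =>
    rw [← Set.union_singleton, ← Set.sdiff_sdiff]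
    exact ih.diff_singleton a

theorem lt_or_eq_or_lt (x y : U.HyperNat) : U.Lt x y ∨ x = y ∨ U.Lt y x := by
  have h := (U.transfer (.all 0 0 (.all 0 1 (.or (.rel 0 0 1) (.or (.eq 0 0 1) (.rel 0 1 0)))))
    stdEnv).1 (by
      simp
      exact fun a b => Nat.lt_trichotomy a b)
  simp at h
  exact h x y

/-- The order of `*ℕ` need not be well-founded, but the least number principle transfers to internal
sections. -/
theorem exists_leastGraph {P : Set (U.HyperNat × U.HyperNat)} (hP : U.IsInternalRel P)
    {x y : U.HyperNat} (hxy : (x, y) ∈ P) : ∃ z, (x, z) ∈ leastGraph P := by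
  have h := (U.transfer (.all 3 1 (.all 0 0 (.all 0 1 (.imp (.rel 1 0 1) (.ex 0 2
    (.and (.rel 1 0 2) (.all 0 3 (.imp (.rel 0 3 2) (.neg (.rel 1 0 3)))))))))) stdEnv).1 (by
      simp
      intro R a b hab
      obtain ⟨c, hc, hmin⟩ := Nat.lt_wfRel.wf.has_min {c : ℕ | standard.Rel R a c} ⟨b, hab⟩
      exact ⟨c, hc, fun d hd hR => hmin d hR hd⟩)
  simp at h
  obtain ⟨a, ha⟩ := isInternalRel_iff.1 hP
  obtain ⟨z, hz, hmin⟩ := h a x y ((ha x y).1 hxy)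
  refine ⟨z, (ha x z).2 hz, ?_⟩
  rintro ⟨-, w, hw, hxw⟩
  exact hmin w hw ((ha x w).1 hxw)

theorem leastGraph_unique {P : Set (U.HyperNat × U.HyperNat)} {x y z : U.HyperNat}
    (hy : (x, y) ∈ leastGraph P) (hz : (x, z) ∈ leastGraph P) : y = z := by
  rcases lt_or_eq_or_lt y z with h | h | h
  · exact (hz.2 ⟨hz.1, y, h, hy.1⟩).elim
  · exact h
  · exact (hy.2 ⟨hy.1, z, h, hz.1⟩).elim

/-- A partial internal regressive function admits an internal colouring with two colours in which
every point differs from its image. -/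
theorem IsInternalRel.exists_coloring {P : Set (U.HyperNat × U.HyperNat)}
    (hP : U.IsInternalRel P) (huniq : ∀ x y z, (x, y) ∈ P → (x, z) ∈ P → y = z) :
    ∃ A : Set U.HyperNat, U.IsInternal A ∧
      ∀ x y, (x, y) ∈ P → U.Lt y x → (x ∈ A ↔ y ∉ A) := by
  have h := (U.transfer (.all 3 1 (.imp
    (.all 0 0 (.all 0 1 (.all 0 2 (.imp (.rel 1 0 1) (.imp (.rel 1 0 2) (.eq 0 1 2))))))
    (.ex 1 1 (.all 0 0 (.all 0 1 (.imp (.rel 1 0 1) (.imp (.rel 0 1 0)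
      (.iff (.mem 0 0 1) (.neg (.mem 0 1 1)))))))))) stdEnv).1 (by
      simp
      intro R hR
      obtain ⟨A, hA⟩ := exists_coloring_of_regressive (fun x y => standard.Rel R x y) hR
      exact ⟨({x : ℕ | A x} : Set ℕ), hA⟩)
  simp at h
  obtain ⟨a, ha⟩ := isInternalRel_iff.1 hP
  obtain ⟨b, hb⟩ := h a fun x y z hy hz => huniq x y z ((ha x y).2 hy) ((ha x z).2 hz)
  exact ⟨{x | U.mem 0 x b}, ⟨b, rfl⟩, fun x y hxy hlt => hb x y ((ha x y).1 hxy) hlt⟩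

/-- If a section of an internal relation is finite, its points are obtained by successively
removing least points. -/
theorem exists_leastGraph_iterate_of_finite {P : Set (U.HyperNat × U.HyperNat)}
    (hP : U.IsInternalRel P) {x y : U.HyperNat} (hfin : {z | (x, z) ∈ P}.Finite)
    (hxy : (x, y) ∈ P) : ∃ i : ℕ, (x, y) ∈ leastGraph (removeLeast^[i] P) := by
  induction hn : {z | (x, z) ∈ P}.ncard using Nat.strong_induction_on generalizing P with
  | _ n ih =>
    obtain ⟨z, hz⟩ := exists_leastGraph hP hxy
    by_cases hy : (x, y) ∈ removeLeast P
    · have hsub : {w | (x, w) ∈ removeLeast P} ⊂ {w | (x, w) ∈ P} :=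
        ⟨fun w hw => hw.1, fun h => hz.2 (h hz.1)⟩
      obtain ⟨i, hi⟩ := ih _ (hn ▸ Set.ncard_lt_ncard hsub hfin) hP.removeLeast
        (hfin.subset hsub.subset) hy rfl
      exact ⟨i + 1, hi⟩
    · exact ⟨0, hxy, hy⟩

/-! ### Consequences of saturation -/

theorem CountablySaturated.exists_mem_iInter (hU : U.CountablySaturated)
    {X : ℕ → Set U.HyperNat} (hX : ∀ k, U.IsInternal (X k)) (hanti : Antitone X)
    (hne : ∀ k, (X k).Nonempty) : ∃ x, ∀ k, x ∈ X k := by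
  choose b hb using fun k => isInternal_iff.1 (hX k)
  obtain ⟨x, hx⟩ := hU 0 b fun k => by
    obtain ⟨x, hx⟩ := hne k
    exact ⟨x, fun i hi => (hb i x).1 (hanti hi hx)⟩
  exact ⟨x, fun k => (hb k x).2 (hx k)⟩

/-- A countable decreasing intersection of internal sets which is countable is contained in
a finite one of them. -/
theorem CountablySaturated.exists_finite (hU : U.CountablySaturated)
    {X : ℕ → Set U.HyperNat} (hX : ∀ k, U.IsInternal (X k)) (hanti : Antitone X)
    (hcount : (⋂ k, X k).Countable) : ∃ k, (X k).Finite := by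
  by_contra! hinf
  rcases (⋂ k, X k).eq_empty_or_nonempty with he | hne
  · obtain ⟨x, hx⟩ := hU.exists_mem_iInter hX hanti fun k => (hinf k).nonempty
    exact (he ▸ Set.mem_iInter.2 hx : x ∈ (∅ : Set U.HyperNat))
  · obtain ⟨a, ha⟩ := hcount.exists_eq_range hne
    have hfin : ∀ k : ℕ, (a '' Set.Iic k).Finite := fun k => (Set.finite_Iic k).image a
    -- Diagonalization: deleting the points `a 0, …, a k` from the infinite set `X k` keeps it
    -- internal and nonempty, and a common point of the remainders escapes the enumeration `a` of
    -- the intersection.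
    obtain ⟨x, hx⟩ := hU.exists_mem_iInter (X := fun k => X k \ a '' Set.Iic k)
      (fun k => (hX k).diff_finite (hfin k))
      (fun i j hij => Set.sdiff_subset_sdiff (hanti hij)
        (Set.image_mono (Set.Iic_subset_Iic.2 hij)))
      (fun k => ((hinf k).sdiff (hfin k)).nonempty)
    have hmem : x ∈ ⋂ k, X k := Set.mem_iInter.2 fun k => (hx k).1
    rw [ha] at hmem
    obtain ⟨j, rfl⟩ := hmem
    exact (hx j).2 ⟨j, le_refl j, rfl⟩

end NonstandardUniverse

/-! ### Countably determined sets -/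

section CountablyDetermined

variable {α : Type u} {𝓘 : Set α → Prop} {X : Set α}

/-- Membership in a countably determined set depends only on the membership in the sets of
a countable family. -/
theorem CountablyDetermined.exists_invariant (h : CountablyDetermined 𝓘 X) :
    ∃ Y : ℕ → Set α, (∀ m, 𝓘 (Y m)) ∧
      ∀ x y, (∀ m, x ∈ Y m ↔ y ∈ Y m) → x ∈ X → y ∈ X := by
  obtain ⟨Y, B, hY, rfl⟩ := h
  refine ⟨Y, hY, fun x y hxy hx => ?_⟩
  simpa only [Set.mem_iUnion, Set.mem_inter_iff, Set.mem_iInter, Set.mem_sdiff, hxy] using hx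

/-- Since `B` may be any subset of `𝒫(ℕ)`, it can be taken to consist of the membership patterns
realized in `X`; no definability is needed. -/
theorem CountablyDetermined.of_invariant {ι : Type*} [Countable ι] (huniv : 𝓘 Set.univ)
    (Z : ι → Set α) (hZ : ∀ i, 𝓘 (Z i))
    (hX : ∀ x y, (∀ i, x ∈ Z i ↔ y ∈ Z i) → x ∈ X → y ∈ X) : CountablyDetermined 𝓘 X := by
  obtain ⟨f, hf⟩ := exists_surjective_nat (Option ι)
  -- Adjoining `Set.univ` makes the union of the family everything, so relative complements become
  -- true complements.
  let W : Option ι → Set α := fun o => o.elim Set.univ Z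
  have hW : ∀ o, 𝓘 (W o) := by
    rintro (_ | i)
    exacts [huniv, hZ i]
  obtain ⟨n₀, hn₀⟩ := hf none
  have hcover : ⋃ n, W (f n) = Set.univ :=
    Set.eq_univ_of_forall fun x => Set.mem_iUnion.2 ⟨n₀, by rw [hn₀]; trivial⟩
  refine ⟨fun n => W (f n), {b | ∃ x ∈ X, b = {n | x ∈ W (f n)}}, fun n => hW _, ?_⟩
  ext y
  simp only [hcover, Set.mem_iUnion, Set.mem_inter_iff, Set.mem_iInter, Set.mem_sdiff,
    Set.mem_univ, true_and]
  constructor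
  · exact fun hy => ⟨_, ⟨y, hy, rfl⟩, fun m hm => hm, fun m hm => hm⟩
  · rintro ⟨_, ⟨x, hx, rfl⟩, h₁, h₂⟩
    refine hX x y (fun i => ?_) hx
    obtain ⟨n, hn⟩ := hf (some i)
    have h : x ∈ W (f n) ↔ y ∈ W (f n) := ⟨h₁ n, fun hy => by_contra fun hx => h₂ n hx hy⟩
    rwa [hn] at h

end CountablyDetermined

/-! ### Internal covers, transversals and smoothness -/

namespace NonstandardUniverse

variable {U : NonstandardUniverse.{u}}

/-- The points which have a prescribed position with respect to the first `k` sets of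
a sequence. -/
def cylinder {α : Type*} (Y : ℕ → Set α) (k : ℕ) (s : Set ℕ) : Set α :=
  {q | ∀ m < k, q ∈ Y m ↔ m ∈ s}

theorem isInternalRel_cylinder {Y : ℕ → Set (U.HyperNat × U.HyperNat)}
    (hY : ∀ m, U.IsInternalRel (Y m)) (k : ℕ) (s : Set ℕ) :
    U.IsInternalRel (cylinder Y k s) := by
  induction k with
  | zero => simpa [cylinder] using isInternalRel_univ
  | succ k ih =>
    by_cases hk : k ∈ s
    · convert ih.inter (hY k) using 1
      ext q
      simp only [cylinder, Set.mem_ofPred_eq, Nat.forall_lt_succ_right, Set.mem_inter_iff,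
        hk, iff_true]
    · convert ih.inter (hY k).compl using 1
      ext q
      simp only [cylinder, Set.mem_ofPred_eq, Nat.forall_lt_succ_right, Set.mem_inter_iff,
        Set.mem_compl_iff, hk, iff_false]

/-- A countably determined relation with countable sections is covered by countably many
internal partial functions. -/
theorem IsCDRel.exists_cover (hU : U.CountablySaturated) {P : Set (U.HyperNat × U.HyperNat)}
    (hP : U.IsCDRel P) (hcount : ∀ x, {y | (x, y) ∈ P}.Countable) :
    ∃ G : ℕ → Set (U.HyperNat × U.HyperNat), (∀ n, U.IsInternalRel (G n)) ∧
      (∀ n x y z, (x, y) ∈ G n → (x, z) ∈ G n → y = z) ∧ P ⊆ ⋃ n, G n := by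
  obtain ⟨Y, hY, hinv⟩ := CountablyDetermined.exists_invariant hP
  -- A triple `(k, s, i)` codes the map taking `x` to the `i`-th least point, counted from 0, of the
  -- section at `x` of `cylinder Y k s`.
  obtain ⟨f, hf⟩ := exists_surjective_nat (ℕ × Finset ℕ × ℕ)
  have hC := fun k s => isInternalRel_cylinder hY k s
  have hit : ∀ k s i, U.IsInternalRel (removeLeast^[i] (cylinder Y k s)) := by
    intro k s i
    induction i with
    | zero => exact hC k s
    | succ i ih =>
      rw [iterate_succ_apply']
      exact ih.removeLeast
  refine ⟨fun n => leastGraph (removeLeast^[(f n).2.2] (cylinder Y (f n).1 (f n).2.1)),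
    fun n => (hit _ _ _).leastGraph, fun n x y z => leastGraph_unique, ?_⟩
  rintro ⟨x, y⟩ hxy
  let b : Set ℕ := {m | (x, y) ∈ Y m}
  obtain ⟨k, hk⟩ := hU.exists_finite (X := fun k => {z | (x, z) ∈ cylinder Y k b})
    (fun k => (hC k b).section x) (fun i j hij z hz m hm => hz m (hm.trans_le hij))
    ((hcount x).mono fun z hz => hinv (x, y) (x, z)
      (fun m => (Set.mem_iInter.1 hz (m + 1) m m.lt_succ_self).symm) hxy)
  classical
  -- Only the part of `b` below `k` matters, and finite patterns are countable in number.
  let s : Finset ℕ := (Finset.range k).filter (· ∈ b)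
  have hs : cylinder Y k b = cylinder Y k s := by
    ext q
    refine forall₂_congr fun m hm => ?_
    simp [s, hm]
  obtain ⟨i, hi⟩ := exists_leastGraph_iterate_of_finite (hC k b) hk
    (show (x, y) ∈ cylinder Y k b from fun m _ => Iff.rfl)
  obtain ⟨n, hn⟩ := hf (k, s, i)
  refine Set.mem_iUnion.2 ⟨n, ?_⟩
  rw [hn, ← hs]
  exact hi

/-- A class may have no least element in the order of `*ℕ`, so the choice is made through `τ`, whose
values lie in a well-ordered set. -/
theorem exists_cd_transversal (hU : U.CountablySaturated) (E : Setoid U.HyperNat)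
    (hE : U.IsCDRel {q | E q.1 q.2}) (hcount : ∀ x : U.HyperNat, {y | E x y}.Countable) :
    ∃ T : Set U.HyperNat, U.IsCD T ∧ IsTransversal E T := by
  obtain ⟨G, hG, huniq, hcover⟩ := hE.exists_cover hU hcount
  obtain ⟨Y, hY, hinv⟩ := CountablyDetermined.exists_invariant hE
  choose A hA hcol using fun n => (hG n).exists_coloring (huniq n)
  have hcov : ∀ {x y}, E x y → ∃ n, (x, y) ∈ G n := fun {x y} h =>
    Set.mem_iUnion.1 (@hcover (x, y) h)
  let τ : U.HyperNat → Set ℕ := fun x => {n | x ∈ A n}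
  let r : Set ℕ → Set ℕ → Prop := WellOrderingRel
  have hr : WellFounded r := WellOrderingRel.isWellOrder.wf
  refine ⟨{x | ∀ y, E x y → ¬ r (τ y) (τ x)}, ?_, fun x => ?_⟩
  -- These sets record `τ x`, whether the value `G n x` exists, the colours of that value, and the
  -- position of `(x, G n x)` with respect to each `Y m`. The last is needed because `G n` need not
  -- lie inside `E`.
  · refine CountablyDetermined.of_invariant (ι := ℕ ⊕ ℕ ⊕ (ℕ × ℕ) ⊕ (ℕ × ℕ)) isInternal_univ
      (Sum.elim A (Sum.elim (fun n => {x | ∃ y, (x, y) ∈ G n})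
        (Sum.elim (fun i => {x | ∃ y, (x, y) ∈ G i.1 ∧ y ∈ A i.2})
          (fun i => {x | ∃ y, (x, y) ∈ G i.1 ∩ Y i.2})))) ?_ ?_
    · rintro (n | n | ⟨n, k⟩ | ⟨n, m⟩)
      · exact hA n
      · exact (hG n).dom
      · exact (hG n).preimage (hA k)
      · exact ((hG n).inter (hY m)).dom
    · intro x x' hxx' hx y' hy' hlt
      have hτ : τ x = τ x' := Set.ext fun n => hxx' (.inl n)
      obtain ⟨n, hn'⟩ := hcov hy'
      obtain ⟨y, hn⟩ := (hxx' (.inr (.inl n))).2 ⟨y', hn'⟩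
      -- As `G n` is single-valued, statements about some value at `x` and at `x'` are statements
      -- about `y` and `y'`.
      have hval : ∀ Q Q' : U.HyperNat → Prop,
          ((∃ z, (x, z) ∈ G n ∧ Q z) ↔ ∃ z, (x', z) ∈ G n ∧ Q' z) → (Q y ↔ Q' y') := by
        intro Q Q' h
        constructor
        · intro hQ
          obtain ⟨z, hz, hQz⟩ := h.1 ⟨y, hn, hQ⟩
          rwa [huniq n x' y' z hn' hz]
        · intro hQ
          obtain ⟨z, hz, hQz⟩ := h.2 ⟨y', hn', hQ⟩
          rwa [huniq n x y z hn hz]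
      have hτy : τ y = τ y' := Set.ext fun k => hval _ _ (hxx' (.inr (.inr (.inl (n, k)))))
      have hEy : E x y := hinv (x', y') (x, y) (fun m => (hval (fun z => (x, z) ∈ Y m)
        (fun z => (x', z) ∈ Y m) (hxx' (.inr (.inr (.inr (n, m)))))).symm) hy'
      exact hx y hEy (by rwa [hτ, hτy])
  · obtain ⟨y, hxy, hmin⟩ := (InvImage.wf τ hr).has_min {y | E x y} ⟨x, E.refl x⟩
    have hy : ∀ z, E y z → ¬ r (τ z) (τ y) := fun z hz => hmin z (E.trans hxy hz)
    refine ⟨y, ⟨hy, hxy⟩, ?_⟩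
    rintro z ⟨hz, hxz⟩
    have hyz : E y z := E.trans (E.symm hxy) hxz
    have hτ : τ z = τ y := by
      rcases trichotomous_of (WellOrderingRel (α := Set ℕ)) (τ z) (τ y) with h | h | h
      · exact (hy z hyz h).elim
      · exact h
      · exact (hz y (E.symm hyz) h).elim
    -- Injectivity of `τ` on a class: some `G n` sends the larger point `v` to the smaller point
    -- `w`, so `A n` would separate them.
    have key : ∀ v w, E v w → τ v = τ w → ¬ U.Lt w v := by
      intro v w hvw hτ hlt
      obtain ⟨n, hn⟩ := hcov hvw
      have h₁ : v ∈ A n ↔ w ∈ A n := Set.ext_iff.1 hτ n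
      have h₂ := hcol n v w hn hlt
      tauto
    rcases lt_or_eq_or_lt z y with h | h | h
    · exact (key y z hyz hτ.symm h).elim
    · exact h
    · exact (key z y (E.symm hyz) hτ h).elim

/-- A countably determined equivalence relation with a countably determined transversal is
CD-smooth. -/
theorem cdSmooth_of_transversal {E : Setoid U.HyperNat} (hE : U.IsCDRel {q | E q.1 q.2})
    {T : Set U.HyperNat} (hT : U.IsCD T) (hET : IsTransversal E T) : U.CDSmooth E := by
  choose θ hθ hθuniq using hET
  obtain ⟨Y, hY, hinvY⟩ := CountablyDetermined.exists_invariant hE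
  obtain ⟨Z, hZ, hinvZ⟩ := CountablyDetermined.exists_invariant hT
  refine ⟨θ, ?_, fun x y => ⟨fun h => ?_, fun h => ?_⟩⟩
  -- The graph of `θ` consists of the pairs `(x, y)` with `E x y` and `y ∈ T`, so the sets
  -- determining `E` and `T` determine it.
  · refine CountablyDetermined.of_invariant (ι := ℕ ⊕ ℕ) isInternalRel_univ
      (Sum.elim Y fun n => {q | q.2 ∈ Z n}) ?_ ?_
    · rintro (n | n)
      exacts [hY n, (hZ n).preimage_snd]
    · rintro ⟨x, y⟩ ⟨x', y'⟩ h hxy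
      obtain rfl : θ x = y := hxy
      exact (hθuniq x' y' ⟨hinvZ _ _ (fun n => h (.inr n)) (hθ x).1,
        hinvY _ _ (fun n => h (.inl n)) (hθ x).2⟩).symm
  · exact hθuniq y (θ x) ⟨(hθ x).1, E.trans (E.symm h) (hθ x).2⟩
  · exact E.trans (hθ x).2 (h ▸ E.symm (hθ y).2)

end NonstandardUniverse

end NonstandardDST

theorem mainTheorem1 (U : NonstandardDST.NonstandardUniverse.{u}) (hU : U.CountablySaturated)
    (E : Setoid U.HyperNat) (hE : U.IsCDRel {q | E q.1 q.2})
    (hcount : ∀ x : U.HyperNat, {y | E x y}.Countable) :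
    (∃ T : Set U.HyperNat, U.IsCD T ∧ NonstandardDST.IsTransversal E T) ∧ U.CDSmooth E := by
  obtain ⟨T, hT, hET⟩ := NonstandardDST.NonstandardUniverse.exists_cd_transversal hU E hE hcount
  exact ⟨⟨T, hT, hET⟩, NonstandardDST.NonstandardUniverse.cdSmooth_of_transversal hE hT hET⟩
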